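/- **Theorem 4.10.** Let $X$ be a normed vector lattice, i.e. a real vector lattice with a norm such that $|x|\le|y|$ implies $\|x\|\le\|y\|$. Let $C\subset X_+$ be a nonzero max-cone: $C\neq\{0\}$, $C\ne\emptyset$, $tx\in C$ for all $t\ge 0$, $x\in C$, and the supremum $x\vee y$ (taken in $X$) belongs to $C$ for all $x,y\in C$. Let $A:C\to C$ be Lipschitz (there is $L>0$ with $\|Ax-Ay\|\le L\|x-y\|$ for all $x,y\in C$), positively homogeneous ($A(tx)=tAx$ for all $t\ge0$, $x\in C$) and such that $A(x\vee y)=Ax\vee Ay$ for all $x,y\in C$. Let $q(z)=\sum_{j=0}^n\alpha_jz^j$ be a polynomial with real coefficients $\alpha_j\ge0$, and put $$q_\vee(t)=\max_{0\le j\le n}\alpha_jt^j\quad(t\ge0),\qquad q_\vee(A)x=\bigvee_{j=0}^n\alpha_jA^jx\quad(x\in C).$$ For a map $B:C\to C$ let $\sigma_{ap}(B)$ be the set of all $s\ge0$ with $\inf\{\|Bx-sx\|:x\in C,\ \|x\|=1\}=0$, let $m(B)=\inf\{\|Bx\|:x\in C,\ \|x\|=1\}$, and let $d(B)=\lim_{k\to\infty}m(B^k)^{1/k}$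 whenever this limit exists. Then $$\sigma_{ap}(q_\vee(A))=q_\vee(\sigma_{ap}(A)).$$ Moreover, the limits $d(A)$ and $d(q_\vee(A))$ exist and $$d(q_\vee(A))=q_\vee(d(A)).$$ -/

import Mathlib

open Filter Topology

namespace MaxSpectral

/-- A max-cone `C ⊆ X₊` in a vector lattice `X`: a set of positive vectors which is invariant under
multiplication by nonnegative scalars and contains the supremum `x ⊔ y` of any two of its elements.
Convexity and closedness are not required. -/
structure IsMaxCone {X : Type*} [AddCommGroup X] [Lattice X] [Module ℝ X] (C : Set X) : Prop where
  nonneg : ∀ x ∈ C, 0 ≤ x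
  smul_mem : ∀ t : ℝ, 0 ≤ t → ∀ x ∈ C, t • x ∈ C
  sup_mem : ∀ x ∈ C, ∀ y ∈ C, x ⊔ y ∈ C

section Order

variable {X : Type*} [AddCommGroup X] [Lattice X] [Module ℝ X] {C : Set X}

/-- `A (t x) = t A x` for all `t ≥ 0` and `x ∈ C`. -/
def IsPosHomogeneous (hC : IsMaxCone C) (A : C → C) : Prop :=
  ∀ (t : ℝ) (ht : 0 ≤ t) (x : C), (A ⟨t • (x : X), hC.smul_mem t ht x x.2⟩ : X) = t • (A x : X)

/-- `A (x ∨ y) = A x ∨ A y` for all `x, y ∈ C`. -/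
def PreservesSup (hC : IsMaxCone C) (A : C → C) : Prop :=
  ∀ x y : C, (A ⟨(x : X) ⊔ y, hC.sup_mem x x.2 y y.2⟩ : X) = (A x : X) ⊔ A y

/-- The vector `⋁_{j = 0}^{n} α_j A^j x` for `q = ∑_{j = 0}^{n} α_j z^j`, `n = deg q`. -/
noncomputable def maxPolyVec (q : Polynomial ℝ) (A : C → C) (x : C) : X :=
  (Finset.range (q.natDegree + 1)).sup' Finset.nonempty_range_add_one
    fun j => q.coeff j • ((A^[j] x : C) : X)

theorem maxPolyVec_mem (hC : IsMaxCone C) (q : Polynomial ℝ) (hq : ∀ j, 0 ≤ q.coeff j)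
    (A : C → C) (x : C) : maxPolyVec q A x ∈ C :=
  Finset.sup'_mem C hC.sup_mem _ _ _ fun j _ => hC.smul_mem _ (hq j) _ (A^[j] x).2

/-- The map `q_∨(A) : C → C`, `q_∨(A) x = ⋁_{j = 0}^{n} α_j A^j x`. -/
noncomputable def maxPolyMap (hC : IsMaxCone C) (q : Polynomial ℝ) (hq : ∀ j, 0 ≤ q.coeff j)
    (A : C → C) : C → C :=
  fun x => ⟨maxPolyVec q A x, maxPolyVec_mem hC q hq A x⟩

end Order

/-- The max-polynomial function `q_∨(t) = max_{0 ≤ j ≤ n} α_j t^j`. -/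
noncomputable def maxPolyFun (q : Polynomial ℝ) (t : ℝ) : ℝ :=
  (Finset.range (q.natDegree + 1)).sup' Finset.nonempty_range_add_one fun j => q.coeff j * t ^ j

section Norm

variable {X : Type*} [NormedAddCommGroup X] [NormedSpace ℝ X] {C : Set X}

/-- The approximate point spectrum of `A : C → C`: all `s ≥ 0` such that
`inf {‖A x - s x‖ : x ∈ C, ‖x‖ = 1} = 0`. -/
def approxPointSpectrum (A : C → C) : Set ℝ :=
  {s | 0 ≤ s ∧ IsGLB {r : ℝ | ∃ x : C, ‖(x : X)‖ = 1 ∧ r = ‖(A x : X) - s • (x : X)‖} 0}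

/-- The minimum modulus `m(A) = inf {‖A x‖ : x ∈ C, ‖x‖ = 1}`. -/
noncomputable def minModulus (A : C → C) : ℝ :=
  sInf {r : ℝ | ∃ x : C, ‖(x : X)‖ = 1 ∧ r = ‖(A x : X)‖}

/-- The sequence `m(A^n)^{1/n}`. -/
noncomputable def minModulusRoot (A : C → C) (n : ℕ) : ℝ :=
  minModulus (A^[n]) ^ (1 / (n : ℝ))

/-- The lower spectral radius `d(A) = lim_{n → ∞} m(A^n)^{1/n}`. -/
noncomputable def lowerSpectralRadius (A : C → C) : ℝ :=
  limUnder atTop (minModulusRoot A)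

end Norm

end MaxSpectral

/-! Write `B` for `q_∨(A)`. Approximate eigenvectors of `A` at `s` are approximate eigenvectors of
every `A^j` at `s^j`, by the Lipschitz bound, hence of `B` at `q_∨(s)`; this is one inclusion.

The number `d(A)` is the least element of the spectrum of `A`: unit approximate eigenvectors at `s`
give `m(A^n) ≤ s^n`, and `d(A)` itself belongs to the spectrum (`lowerSpectralRadius_mem`). So
`q_∨(d(A))` is in the spectrum of `B` and `d(B) ≤ q_∨(d(A))`; the converse bound follows from `α_j
A^j ≤ B`.

For the other inclusion let `s` be in the spectrum of `B`, so `s ≥ d(B) ≥ q_∨(d(A)) ≥ α_0`. If `s =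
α_0`, then `d(A)` is a preimage. Otherwise `s = q_∨(t)` with `t > 0`; rescale to `A' = t⁻¹ A` and
take approximate eigenvectors `u` of `B` at `s`. A monomial attaining the maximum gives `A'^k u ≤ u`
with `k ≥ 1`, up to a small error, while `u ≤ (α_0/s) u ∨ A' u ∨ ⋯ ∨ A'^n u` up to a small error
with `α_0/s < 1`. This traps an orbit of `A'` between norm bounds.

Both membership proofs end with `exists_norm_map_sub_le`: an orbit segment with controlled growth,
damped exponentially away from its middle, has an almost fixed vector as its supremum. -/

namespace MaxSpectral

/-! ### Lattice inequalities for positive parts, finite suprema and solid norms. -/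

section Lattice

variable {X : Type*} [AddCommGroup X] [Lattice X] [IsOrderedAddMonoid X]

theorem posPart_sub_le_add (x y z : X) : (x - z)⁺ ≤ (x - y)⁺ + (y - z)⁺ := by
  refine sup_le ?_ (add_nonneg (posPart_nonneg _) (posPart_nonneg _))
  calc x - z = (x - y) + (y - z) := by abel
    _ ≤ _ := add_le_add (le_posPart _) (le_posPart _)

theorem posPart_sup'_sub_le {ι : Type*} {s : Finset ι} (hs : s.Nonempty) (f : ι → X) (v : X) :
    (s.sup' hs f - v)⁺ ≤ ∑ i ∈ s, (f i - v)⁺ := by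
  refine sup_le ?_ (Finset.sum_nonneg fun _ _ => posPart_nonneg _)
  rw [sub_le_iff_le_add]
  refine Finset.sup'_le _ _ fun i hi => ?_
  rw [← sub_le_iff_le_add]
  exact (le_posPart _).trans
    (Finset.single_le_sum (f := fun i => (f i - v)⁺) (fun _ _ => posPart_nonneg _) hi)

theorem abs_sup'_sub_sup'_le {ι : Type*} {s : Finset ι} (hs : s.Nonempty) (f g : ι → X) :
    |s.sup' hs f - s.sup' hs g| ≤ ∑ i ∈ s, |f i - g i| := by
  have key : ∀ f g : ι → X, s.sup' hs f - s.sup' hs g ≤ ∑ i ∈ s, |f i - g i| := by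
    intro f g
    rw [sub_le_iff_le_add]
    refine Finset.sup'_le _ _ fun i hi => ?_
    have h1 : f i - g i ≤ ∑ i ∈ s, |f i - g i| := (le_abs_self _).trans
      (Finset.single_le_sum (f := fun i => |f i - g i|) (fun _ _ => abs_nonneg _) hi)
    calc f i = (f i - g i) + g i := by abel
      _ ≤ _ := add_le_add h1 (Finset.le_sup' g hi)
  refine sup_le (key f g) ?_
  rw [neg_sub]
  simpa only [abs_sub_comm] using key g f

end Lattice

section OrderedModule

variable {X : Type*} [AddCommGroup X] [Lattice X] [Module ℝ X] [IsOrderedModule ℝ X]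

theorem smul_sup_of_nonneg {t : ℝ} (ht : 0 ≤ t) (x y : X) : t • (x ⊔ y) = t • x ⊔ t • y := by
  rcases ht.eq_or_lt with rfl | ht
  · simp
  · have : PosSMulReflectLE ℝ X := PosSMulMono.toPosSMulReflectLE
    exact (OrderIso.smulRight ht).map_sup x y

theorem smul_sup'_of_nonneg {ι : Type*} {s : Finset ι} (hs : s.Nonempty) {t : ℝ} (ht : 0 ≤ t)
    (f : ι → X) : t • s.sup' hs f = s.sup' hs fun i => t • f i :=
  Finset.apply_sup'_eq_sup'_comp hs (fun x => t • x) (smul_sup_of_nonneg ht)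

theorem posPart_smul_of_nonneg {t : ℝ} (ht : 0 ≤ t) (x : X) : (t • x)⁺ = t • x⁺ := by
  simp [posPart_def, smul_sup_of_nonneg ht]

/-- If `x ≤ a x ∨ w` holds up to an error, with `a < 1`, then `x ≤ w` holds up to a multiple of
that error. -/
theorem smul_posPart_sub_le [IsOrderedAddMonoid X] {x w : X} (hx : 0 ≤ x) (hw : 0 ≤ w) {a : ℝ}
    (ha0 : 0 ≤ a) (ha1 : a < 1) : (1 - a) • (x - w)⁺ ≤ (x - (a • x ⊔ w))⁺ := by
  have h1 : (x - w)⁺ ≤ x := sup_le (sub_le_self _ hw) hx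
  have h2 : (1 - a) • (x - w)⁺ ≤ (1 - a) • x := smul_le_smul_of_nonneg_left h1 (by linarith)
  have h3 : (1 - a) • (x - w)⁺ ≤ (x - w)⁺ := by
    rw [sub_smul, one_smul]
    exact sub_le_self _ (smul_nonneg ha0 (posPart_nonneg _))
  -- Subtraction turns the join into a meet; by distributivity its positive part dominates whatever
  -- lies below both `(1 - a) x` and `(x - w)⁺`.
  have h4 : x - (a • x ⊔ w) = ((1 - a) • x) ⊓ (x - w) := by
    rw [sub_sup, sub_smul, one_smul]
  have hdistrib : ∀ x y z : X, (x ⊔ y) ⊓ (x ⊔ z) ≤ x ⊔ (y ⊓ z) :=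
    (AddCommGroup.toDistribLattice X).le_sup_inf
  have h0 : (0 : X) ≤ (1 - a) • x := smul_nonneg (by linarith) hx
  calc (1 - a) • (x - w)⁺ ≤ (0 ⊔ (1 - a) • x) ⊓ (0 ⊔ (x - w)) := by
        rw [sup_eq_right.2 h0, sup_comm]; exact le_inf h2 h3
    _ ≤ _ := by rw [h4, posPart_def, sup_comm _ (0 : X)]; exact hdistrib _ _ _

end OrderedModule

section Norm

variable {X : Type*} [NormedAddCommGroup X] [Lattice X] [HasSolidNorm X]

theorem norm_le_norm_of_abs_le {x y : X} (h : |x| ≤ y) : ‖x‖ ≤ ‖y‖ :=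
  norm_le_norm_of_abs_le_abs (h.trans (le_abs_self y))

variable [IsOrderedAddMonoid X]

theorem norm_le_norm_of_nonneg_of_le {x y : X} (hx : 0 ≤ x) (hxy : x ≤ y) : ‖x‖ ≤ ‖y‖ :=
  norm_le_norm_of_abs_le_abs (by rwa [abs_of_nonneg hx, abs_of_nonneg (hx.trans hxy)])

theorem norm_posPart_le (x : X) : ‖x⁺‖ ≤ ‖x‖ :=
  norm_le_norm_of_abs_le_abs <| by
    rw [abs_of_nonneg (posPart_nonneg x)]; exact sup_le (le_abs_self _) (abs_nonneg _)

theorem norm_le_add_norm_posPart_sub {x : X} (hx : 0 ≤ x) (y : X) :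
    ‖x‖ ≤ ‖y‖ + ‖(x - y)⁺‖ := by
  refine (norm_le_norm_of_nonneg_of_le hx (y := y + (x - y)⁺) ?_).trans (norm_add_le _ _)
  rw [← sub_le_iff_le_add']; exact le_posPart _

end Norm

/-! ### Max-linear maps on a cone and suprema of their orbits. -/

section MaxLinear

variable {X : Type*} [NormedAddCommGroup X] [NormedSpace ℝ X] [Lattice X]
  {C : Set X} {hC : IsMaxCone C} {A B : C → C} {L : NNReal}

/-- `A : C → C` is positively homogeneous, preserves suprema and is Lipschitz with constant `L`. -/
structure IsMaxLinear (hC : IsMaxCone C) (A : C → C) (L : NNReal) : Prop where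
  hom : IsPosHomogeneous hC A
  sup : PreservesSup hC A
  lip : LipschitzWith L A

/-- The vector `t x` of the max-cone `C`. -/
def coneSMul (hC : IsMaxCone C) (t : ℝ) (ht : 0 ≤ t) (x : C) : C :=
  ⟨t • (x : X), hC.smul_mem t ht x x.2⟩

/-- The vector `x ∨ y` of the max-cone `C`. -/
def coneSup (hC : IsMaxCone C) (x y : C) : C :=
  ⟨(x : X) ⊔ y, hC.sup_mem x x.2 y y.2⟩

@[simp] theorem coe_coneSMul (t : ℝ) (ht : 0 ≤ t) (x : C) :
    (coneSMul hC t ht x : X) = t • (x : X) := rfl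

@[simp] theorem coe_coneSup (x y : C) : (coneSup hC x y : X) = (x : X) ⊔ y := rfl

/-- The map `x ↦ t A x`. -/
def scaleMap (hC : IsMaxCone C) (t : ℝ) (ht : 0 ≤ t) (A : C → C) : C → C :=
  fun x => coneSMul hC t ht (A x)

/-- The vector `⋁_{j = 0}^{n} c_j A^j x` of the max-cone `C`. -/
noncomputable def orbitSup (hC : IsMaxCone C) (c : ℕ → ℝ) (hc : ∀ j, 0 ≤ c j) (n : ℕ) (A : C → C)
    (x : C) : C :=
  ⟨(Finset.range (n + 1)).sup' Finset.nonempty_range_add_one fun j => c j • ((A^[j] x : C) : X),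
    Finset.sup'_mem C hC.sup_mem _ _ _ fun j _ => hC.smul_mem _ (hc j) _ (A^[j] x).2⟩

theorem coe_orbitSup (c : ℕ → ℝ) (hc : ∀ j, 0 ≤ c j) (n : ℕ) (A : C → C) (x : C) :
    (orbitSup hC c hc n A x : X) =
      (Finset.range (n + 1)).sup' Finset.nonempty_range_add_one
        fun j => c j • ((A^[j] x : C) : X) := rfl

theorem smul_iterate_le_orbitSup (c : ℕ → ℝ) (hc : ∀ j, 0 ≤ c j) {n j : ℕ} (hj : j ≤ n)
    (A : C → C) (x : C) : c j • ((A^[j] x : C) : X) ≤ orbitSup hC c hc n A x :=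
  Finset.le_sup' (fun j => c j • ((A^[j] x : C) : X)) (Finset.mem_range.2 (Nat.lt_succ_of_le hj))

theorem orbitSup_le {c : ℕ → ℝ} {hc : ∀ j, 0 ≤ c j} {n : ℕ} {A : C → C} {x : C} {v : X}
    (h : ∀ j ≤ n, c j • ((A^[j] x : C) : X) ≤ v) : (orbitSup hC c hc n A x : X) ≤ v :=
  Finset.sup'_le Finset.nonempty_range_add_one _ fun j hj =>
    h j (Nat.lt_succ_iff.1 (Finset.mem_range.1 hj))

theorem maxPolyMap_eq_orbitSup (q : Polynomial ℝ) (hq : ∀ j, 0 ≤ q.coeff j) (A : C → C) :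
    maxPolyMap hC q hq A = orbitSup hC q.coeff hq q.natDegree A := rfl

namespace IsMaxLinear

theorem map_smul (hA : IsMaxLinear hC A L) (t : ℝ) (ht : 0 ≤ t) (x : C) :
    A (coneSMul hC t ht x) = coneSMul hC t ht (A x) := Subtype.ext (hA.hom t ht x)

theorem map_sup (hA : IsMaxLinear hC A L) (x y : C) :
    A (coneSup hC x y) = coneSup hC (A x) (A y) := Subtype.ext (hA.sup x y)

theorem norm_map_sub_le (hA : IsMaxLinear hC A L) (x y : C) :
    ‖(A x : X) - A y‖ ≤ L * ‖(x : X) - y‖ := by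
  have := hA.lip.dist_le_mul x y
  rwa [Subtype.dist_eq, Subtype.dist_eq, dist_eq_norm, dist_eq_norm] at this

theorem mono (hA : IsMaxLinear hC A L) {x y : C} (h : (x : X) ≤ y) : (A x : X) ≤ A y := by
  have h1 : coneSup hC x y = y := Subtype.ext (sup_eq_right.2 h)
  have h2 := congrArg Subtype.val (hA.map_sup x y)
  rw [h1] at h2
  rw [h2]
  exact le_sup_left

theorem norm_map_le (hA : IsMaxLinear hC A L) (x : C) : ‖(A x : X)‖ ≤ L * ‖(x : X)‖ := by
  have h1 : (A (coneSMul hC 0 le_rfl x) : X) = 0 := by simp [hA.map_smul]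
  simpa [h1] using hA.norm_map_sub_le x (coneSMul hC 0 le_rfl x)

protected theorem id (hC : IsMaxCone C) : IsMaxLinear hC (id : C → C) 1 :=
  ⟨fun _ _ _ => rfl, fun _ _ => rfl, LipschitzWith.id⟩

protected theorem comp {M : NNReal} (hA : IsMaxLinear hC A L) (hB : IsMaxLinear hC B M) :
    IsMaxLinear hC (A ∘ B) (L * M) where
  hom t ht x := by
    change ((A (B (coneSMul hC t ht x)) : C) : X) = _
    rw [hB.map_smul, hA.map_smul]; rfl
  sup x y := by
    change ((A (B (coneSup hC x y)) : C) : X) = _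
    rw [hB.map_sup, hA.map_sup]; rfl
  lip := hA.lip.comp hB.lip

theorem iterate (hA : IsMaxLinear hC A L) (n : ℕ) : IsMaxLinear hC A^[n] (L ^ n) := by
  induction n with
  | zero => simpa using IsMaxLinear.id hC
  | succ n ih => rw [Function.iterate_succ, pow_succ]; exact ih.comp hA

protected theorem scaleMap [IsOrderedModule ℝ X] (hA : IsMaxLinear hC A L) (t : ℝ) (ht : 0 ≤ t) :
    IsMaxLinear hC (scaleMap hC t ht A) (t.toNNReal * L) where
  hom s hs x := by
    change ((coneSMul hC t ht (A (coneSMul hC s hs x)) : C) : X) = s • (t • (A x : X))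
    rw [hA.map_smul, coe_coneSMul, coe_coneSMul, smul_comm]
  sup x y := by
    change ((coneSMul hC t ht (A (coneSup hC x y)) : C) : X) = t • (A x : X) ⊔ t • (A y : X)
    rw [hA.map_sup, coe_coneSMul, coe_coneSup, smul_sup_of_nonneg ht]
  lip := LipschitzWith.of_dist_le_mul fun x y => by
    rw [Subtype.dist_eq, Subtype.dist_eq, dist_eq_norm, dist_eq_norm]
    change ‖t • (A x : X) - t • (A y : X)‖ ≤ _
    rw [NNReal.coe_mul, Real.coe_toNNReal t ht, ← smul_sub, norm_smul,
      Real.norm_of_nonneg ht, mul_assoc]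
    exact mul_le_mul_of_nonneg_left (hA.norm_map_sub_le x y) ht

theorem iterate_scaleMap (hA : IsMaxLinear hC A L) (t : ℝ) (ht : 0 ≤ t) (n : ℕ) (x : C) :
    (scaleMap hC t ht A)^[n] x = coneSMul hC (t ^ n) (pow_nonneg ht n) (A^[n] x) := by
  induction n with
  | zero => exact Subtype.ext (by simp)
  | succ n ih =>
    rw [Function.iterate_succ_apply', ih, scaleMap, hA.map_smul, Function.iterate_succ_apply']
    exact Subtype.ext (by simp [smul_smul, pow_succ'])

theorem map_finset_sup' (hA : IsMaxLinear hC A L) {s : Finset ℕ} (hs : s.Nonempty) (f : ℕ → C)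
    (z : C) (hz : (z : X) = s.sup' hs fun i => (f i : X)) :
    (A z : X) = s.sup' hs fun i => (A (f i) : X) := by
  induction hs using Finset.Nonempty.cons_induction generalizing z with
  | singleton a =>
    have : z = f a := Subtype.ext (by simpa using hz)
    simp [this]
  | cons a s has hs ih =>
    let w : C := ⟨s.sup' hs fun i => (f i : X),
      Finset.sup'_mem C hC.sup_mem _ _ _ fun j _ => (f j).2⟩
    have hzw : z = coneSup hC (f a) w := Subtype.ext (by rw [hz, Finset.sup'_cons hs]; rfl)
    rw [Finset.sup'_cons hs, hzw, hA.map_sup, coe_coneSup, ih w rfl]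

theorem map_orbitSup (hA : IsMaxLinear hC A L) (c : ℕ → ℝ) (hc : ∀ j, 0 ≤ c j) (n : ℕ) (x : C) :
    (A (orbitSup hC c hc n A x) : X) =
      (Finset.range (n + 1)).sup' Finset.nonempty_range_add_one
        fun j => c j • ((A^[j + 1] x : C) : X) := by
  rw [hA.map_finset_sup' Finset.nonempty_range_add_one (fun j => coneSMul hC (c j) (hc j) (A^[j] x))
    (orbitSup hC c hc n A x) rfl]
  simp only [hA.map_smul, coe_coneSMul, Function.iterate_succ_apply']

variable [IsOrderedAddMonoid X] [HasSolidNorm X]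

/-- Since `(x ∨ y) - y = (x - y)⁺`, the Lipschitz bound for the pair `x ∨ y`, `y` becomes one-sided.
This lets asymptotic inequalities pass through `A`. -/
theorem norm_posPart_map_sub_le (hA : IsMaxLinear hC A L) (x y : C) :
    ‖((A x : X) - A y)⁺‖ ≤ L * ‖((x : X) - y)⁺‖ := by
  have h1 : ((A x : X) - A y)⁺ ≤ (A (coneSup hC x y) : X) - A y := by
    rw [hA.map_sup, coe_coneSup]
    exact sup_le (sub_le_sub_right le_sup_left _) (sub_nonneg.2 le_sup_right)
  refine (norm_le_norm_of_nonneg_of_le (posPart_nonneg _) h1).trans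
    ((hA.norm_map_sub_le _ _).trans_eq ?_)
  rw [coe_coneSup, sup_sub, sub_self, posPart_def]

theorem norm_orbitSup_sub_le (c : ℕ → ℝ) (hc : ∀ j, 0 ≤ c j) (n : ℕ)
    (A : C → C) (x : C) (f : ℕ → X) :
    ‖(orbitSup hC c hc n A x : X) - (Finset.range (n + 1)).sup' Finset.nonempty_range_add_one
      fun j => c j • f j‖ ≤ ∑ j ∈ Finset.range (n + 1), c j * ‖((A^[j] x : C) : X) - f j‖ := by
  rw [coe_orbitSup]
  refine (norm_le_norm_of_abs_le (abs_sup'_sub_sup'_le _ _ _)).trans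
    ((norm_sum_le _ _).trans (Finset.sum_le_sum fun j _ => ?_))
  rw [norm_abs_eq_norm, ← smul_sub, norm_smul, Real.norm_of_nonneg (hc j)]

theorem norm_orbitSup_le (hA : IsMaxLinear hC A L) (c : ℕ → ℝ) (hc : ∀ j, 0 ≤ c j) (n : ℕ) (x : C) :
    ‖(orbitSup hC c hc n A x : X)‖ ≤ (∑ j ∈ Finset.range (n + 1), c j * (L : ℝ) ^ j) * ‖(x : X)‖ := by
  have h := norm_orbitSup_sub_le (hC := hC) c hc n A x 0
  simp only [Pi.zero_apply, smul_zero, Finset.sup'_const, sub_zero] at h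
  rw [Finset.sum_mul]
  refine h.trans (Finset.sum_le_sum fun j _ => ?_)
  rw [mul_assoc]
  refine mul_le_mul_of_nonneg_left ?_ (hc j)
  simpa using (hA.iterate j).norm_map_le x

protected theorem orbitSup [IsOrderedModule ℝ X] (hA : IsMaxLinear hC A L)
    (c : ℕ → ℝ) (hc : ∀ j, 0 ≤ c j) (n : ℕ) :
    IsMaxLinear hC (orbitSup hC c hc n A)
      (∑ j ∈ Finset.range (n + 1), (c j).toNNReal * L ^ j) where
  hom t ht x := by
    change ((orbitSup hC c hc n A (coneSMul hC t ht x) : C) : X) = _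
    simp only [coe_orbitSup, (hA.iterate _).map_smul, coe_coneSMul, smul_comm _ t]
    exact (smul_sup'_of_nonneg _ ht _).symm
  sup x y := by
    change ((orbitSup hC c hc n A (coneSup hC x y) : C) : X) = _
    simp only [coe_orbitSup, (hA.iterate _).map_sup, coe_coneSup, smul_sup_of_nonneg (hc _)]
    refine le_antisymm (Finset.sup'_le _ _ fun j hj => sup_le_sup ?_ ?_) (sup_le ?_ ?_)
    · exact Finset.le_sup' (fun j => c j • ((A^[j] x : C) : X)) hj
    · exact Finset.le_sup' (fun j => c j • ((A^[j] y : C) : X)) hj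
    · exact Finset.sup'_mono_fun fun _ _ => le_sup_left
    · exact Finset.sup'_mono_fun fun _ _ => le_sup_right
  lip := LipschitzWith.of_dist_le_mul fun x y => by
    rw [Subtype.dist_eq, Subtype.dist_eq, dist_eq_norm, dist_eq_norm]
    refine (norm_orbitSup_sub_le c hc n A x fun j => (A^[j] y : C)).trans ?_
    rw [NNReal.coe_sum, Finset.sum_mul]
    refine Finset.sum_le_sum fun j _ => ?_
    rw [NNReal.coe_mul, Real.coe_toNNReal _ (hc j), mul_assoc]
    exact mul_le_mul_of_nonneg_left ((hA.iterate j).norm_map_sub_le x y) (hc j)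

end IsMaxLinear

end MaxLinear

/-! ### Approximate eigenvectors and the minimum modulus. -/

section Spectrum

variable {X : Type*} [NormedAddCommGroup X] {C : Set X} {A : C → C}

theorem mem_approxPointSpectrum_iff [NormedSpace ℝ X] {s : ℝ} : s ∈ approxPointSpectrum A ↔
    0 ≤ s ∧ ∀ ε > 0, ∃ x : C, ‖(x : X)‖ = 1 ∧ ‖(A x : X) - s • (x : X)‖ ≤ ε := by
  refine and_congr_right fun _ => ⟨fun h ε hε => ?_, fun h => ⟨?_, fun b hb => ?_⟩⟩
  · obtain ⟨_, ⟨x, hx, rfl⟩, -, h2⟩ := h.exists_between hε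
    exact ⟨x, hx, h2.le⟩
  · rintro _ ⟨x, -, rfl⟩
    exact norm_nonneg _
  · refine le_of_forall_pos_le_add fun ε hε => ?_
    obtain ⟨x, hx, h1⟩ := h ε hε
    simpa using (hb ⟨x, hx, rfl⟩).trans h1

theorem exists_norm_eq_one_of_mem_approxPointSpectrum [NormedSpace ℝ X] {s : ℝ}
    (hs : s ∈ approxPointSpectrum A) :
    ∃ x : C, ‖(x : X)‖ = 1 :=
  let ⟨x, hx, _⟩ := (mem_approxPointSpectrum_iff.1 hs).2 1 one_pos
  ⟨x, hx⟩

theorem minModulus_nonneg (A : C → C) : 0 ≤ minModulus A :=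
  Real.sInf_nonneg <| by rintro _ ⟨x, -, rfl⟩; exact norm_nonneg _

theorem minModulus_le {x : C} (hx : ‖(x : X)‖ = 1) : minModulus A ≤ ‖(A x : X)‖ :=
  csInf_le ⟨0, by rintro _ ⟨x, -, rfl⟩; exact norm_nonneg _⟩ ⟨x, hx, rfl⟩

theorem le_minModulus (hC1 : ∃ x : C, ‖(x : X)‖ = 1) {r : ℝ}
    (h : ∀ x : C, ‖(x : X)‖ = 1 → r ≤ ‖(A x : X)‖) : r ≤ minModulus A := by
  obtain ⟨x, hx⟩ := hC1
  refine le_csInf ⟨_, x, hx, rfl⟩ ?_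
  rintro _ ⟨x, hx, rfl⟩
  exact h x hx

theorem exists_norm_lt_of_minModulus_lt (hC1 : ∃ x : C, ‖(x : X)‖ = 1) {r : ℝ}
    (h : minModulus A < r) : ∃ x : C, ‖(x : X)‖ = 1 ∧ ‖(A x : X)‖ < r := by
  contrapose! h
  exact le_minModulus hC1 h

end Spectrum

/-! ### The lower spectral radius and the damped-orbit criterion. -/

section MaxLinear

variable {X : Type*} [NormedAddCommGroup X] [NormedSpace ℝ X] [Lattice X]
  {C : Set X} {hC : IsMaxCone C} {A : C → C} {L : NNReal}

theorem exists_norm_eq_one (hC : IsMaxCone C) (x : C) (hx : (x : X) ≠ 0) :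
    ‖(coneSMul hC ‖(x : X)‖⁻¹ (inv_nonneg.2 (norm_nonneg _)) x : X)‖ = 1 := by
  rw [coe_coneSMul, norm_smul, norm_inv, norm_norm, inv_mul_cancel₀ (norm_ne_zero_iff.2 hx)]

theorem mem_approxPointSpectrum_of_scaleMap {t : ℝ} (ht : 0 < t)
    (h : 1 ∈ approxPointSpectrum (scaleMap hC t⁻¹ (inv_nonneg.2 ht.le) A)) :
    t ∈ approxPointSpectrum A := by
  rw [mem_approxPointSpectrum_iff] at h ⊢
  refine ⟨ht.le, fun ε hε => ?_⟩
  obtain ⟨x, hx, h1⟩ := h.2 (t⁻¹ * ε) (by positivity)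
  refine ⟨x, hx, ?_⟩
  have h2 : ((scaleMap hC t⁻¹ (inv_nonneg.2 ht.le) A x : C) : X) - (1 : ℝ) • (x : X) =
      t⁻¹ • ((A x : X) - t • (x : X)) := by
    rw [smul_sub, smul_smul, inv_mul_cancel₀ ht.ne']; rfl
  rw [h2, norm_smul, Real.norm_of_nonneg (inv_nonneg.2 ht.le)] at h1
  exact le_of_mul_le_mul_left h1 (inv_pos.2 ht)

namespace IsMaxLinear

theorem minModulus_mul_norm_le (hA : IsMaxLinear hC A L) (x : C) :
    minModulus A * ‖(x : X)‖ ≤ ‖(A x : X)‖ := by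
  by_cases hx : (x : X) = 0
  · simp [hx]
  have h := minModulus_le (A := A) (exists_norm_eq_one hC x hx)
  rwa [hA.map_smul, coe_coneSMul, norm_smul, norm_inv, norm_norm, inv_mul_eq_div,
    le_div_iff₀ (norm_pos_iff.2 hx)] at h

theorem minModulus_iterate_mul_le (hA : IsMaxLinear hC A L) (hC1 : ∃ x : C, ‖(x : X)‖ = 1)
    (j k : ℕ) : minModulus A^[j] * minModulus A^[k] ≤ minModulus A^[j + k] := by
  refine le_minModulus hC1 fun x hx => ?_
  rw [Function.iterate_add_apply]
  exact (mul_le_mul_of_nonneg_left (minModulus_le hx) (minModulus_nonneg _)).trans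
    ((hA.iterate j).minModulus_mul_norm_le _)

theorem minModulus_iterate_eq_zero (hA : IsMaxLinear hC A L) (hC1 : ∃ x : C, ‖(x : X)‖ = 1)
    (h : minModulus A = 0) {n : ℕ} (hn : n ≠ 0) : minModulus A^[n] = 0 := by
  obtain ⟨k, rfl⟩ := Nat.exists_eq_succ_of_ne_zero hn
  refine le_antisymm (le_of_forall_pos_le_add fun ε hε => ?_) (minModulus_nonneg _)
  have hL : 0 < (L : ℝ) ^ k + 1 := by positivity
  obtain ⟨x, hx, h1⟩ := exists_norm_lt_of_minModulus_lt hC1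
    (h.trans_lt (div_pos hε hL))
  have h2 := (hA.iterate k).norm_map_le (A x)
  rw [lt_div_iff₀ hL] at h1
  have h3 := minModulus_le (A := A^[k.succ]) hx
  rw [Function.iterate_succ_apply] at h3
  push_cast at h2
  nlinarith [norm_nonneg (A x : X)]

theorem minModulus_iterate_le_pow (hA : IsMaxLinear hC A L) (hC1 : ∃ x : C, ‖(x : X)‖ = 1)
    (n : ℕ) : minModulus A^[n] ≤ (L : ℝ) ^ n := by
  obtain ⟨x, hx⟩ := hC1
  refine (minModulus_le hx).trans ?_
  simpa [hx] using (hA.iterate n).norm_map_le x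

theorem minModulus_pow_le (hA : IsMaxLinear hC A L) (hC1 : ∃ x : C, ‖(x : X)‖ = 1) {n : ℕ}
    (hn : n ≠ 0) : minModulus A ^ n ≤ minModulus A^[n] := by
  induction n, Nat.one_le_iff_ne_zero.2 hn using Nat.le_induction with
  | base => simp
  | succ n hn' ih =>
    rw [pow_succ]
    exact (mul_le_mul_of_nonneg_right (ih (by omega)) (minModulus_nonneg A)).trans
      (hA.minModulus_iterate_mul_le hC1 n 1)

/-- Fekete's lemma for `-log m(A^n)`, subadditive because `m(A^n)` is supermultiplicative. The limit
is a supremum over `n ≥ 1`, whence the bound. The case `m(A) = 0`, where logarithms are useless, is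
separate. -/
theorem exists_tendsto_minModulusRoot (hA : IsMaxLinear hC A L)
    (hC1 : ∃ x : C, ‖(x : X)‖ = 1) :
    ∃ d, Tendsto (minModulusRoot A) atTop (𝓝 d) ∧ ∀ n ≠ 0, minModulus A^[n] ≤ d ^ n := by
  rcases (minModulus_nonneg A).eq_or_lt with h0 | h0
  · refine ⟨0, ?_, fun n hn => ?_⟩
    · refine tendsto_const_nhds.congr' ?_
      filter_upwards [eventually_ne_atTop 0] with n hn
      rw [minModulusRoot, hA.minModulus_iterate_eq_zero hC1 h0.symm hn, Real.zero_rpow]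
      positivity
    · rw [hA.minModulus_iterate_eq_zero hC1 h0.symm hn, zero_pow hn]
  have hpos : ∀ n ≠ 0, 0 < minModulus A^[n] := fun n hn =>
    (pow_pos h0 n).trans_le (hA.minModulus_pow_le hC1 hn)
  have hpos' : ∀ n, 0 < minModulus A^[n] := fun n => by
    rcases eq_or_ne n 0 with rfl | hn
    · refine one_pos.trans_le (le_minModulus hC1 fun x hx => ?_)
      simp [hx]
    · exact hpos n hn
  have hsub : Subadditive fun n => -Real.log (minModulus A^[n]) := fun m n => by
    have := Real.log_le_log (mul_pos (hpos' m) (hpos' n)) (hA.minModulus_iterate_mul_le hC1 m n)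
    rw [Real.log_mul (hpos' m).ne' (hpos' n).ne'] at this
    linarith
  have hbdd : BddBelow (Set.range fun n : ℕ => -Real.log (minModulus A^[n]) / n) := by
    -- The absolute value also covers `n = 0`, where the quotient is `0` by convention.
    refine ⟨-|Real.log L|, ?_⟩
    rintro _ ⟨n, rfl⟩
    rcases eq_or_ne n 0 with rfl | hn
    · simp
    have hn' : (0 : ℝ) < n := by positivity
    have h1 := Real.log_le_log (hpos' n) (hA.minModulus_iterate_le_pow hC1 n)
    rw [Real.log_pow] at h1
    change _ ≤ -Real.log (minModulus A^[n]) / n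
    rw [le_div_iff₀ hn']
    nlinarith [le_abs_self (Real.log L)]
  refine ⟨Real.exp (-hsub.lim), ?_, fun n hn => ?_⟩
  · refine ((Real.continuous_exp.tendsto _).comp (hsub.tendsto_lim hbdd).neg).congr fun n => ?_
    rw [minModulusRoot, Real.rpow_def_of_pos (hpos' n), Function.comp_apply]
    congr 1
    ring
  · have hn' : (0 : ℝ) < n := by positivity
    have h1 := hsub.lim_le_div hbdd hn
    rw [le_div_iff₀ hn'] at h1
    rw [← Real.exp_nat_mul, ← Real.log_le_iff_le_exp (hpos' n)]
    linarith

theorem tendsto_minModulusRoot (hA : IsMaxLinear hC A L) (hC1 : ∃ x : C, ‖(x : X)‖ = 1) :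
    Tendsto (minModulusRoot A) atTop (𝓝 (lowerSpectralRadius A)) := by
  obtain ⟨d, hd, -⟩ := hA.exists_tendsto_minModulusRoot hC1
  exact tendsto_nhds_limUnder ⟨d, hd⟩

theorem minModulus_iterate_le (hA : IsMaxLinear hC A L) (hC1 : ∃ x : C, ‖(x : X)‖ = 1) {n : ℕ}
    (hn : n ≠ 0) : minModulus A^[n] ≤ lowerSpectralRadius A ^ n := by
  obtain ⟨d, hd, h⟩ := hA.exists_tendsto_minModulusRoot hC1
  rw [tendsto_nhds_unique (hA.tendsto_minModulusRoot hC1) hd]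
  exact h n hn

theorem lowerSpectralRadius_nonneg (hA : IsMaxLinear hC A L) (hC1 : ∃ x : C, ‖(x : X)‖ = 1) :
    0 ≤ lowerSpectralRadius A :=
  ge_of_tendsto' (hA.tendsto_minModulusRoot hC1) fun _ => Real.rpow_nonneg (minModulus_nonneg _) _

variable [IsOrderedAddMonoid X] [IsOrderedModule ℝ X] [HasSolidNorm X]

/-- If the norm of the orbit of `x` does not decrease too fast before the time `K` and does not
increase too fast after it, then damping the orbit exponentially on both sides of `K` gives an
approximate fixed point of `A`. -/
theorem exists_norm_map_sub_le (hA : IsMaxLinear hC A L) {ε : ℝ} (hε : 0 < ε) {K : ℕ} {x : C}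
    (hx : ((A^[K] x : C) : X) ≠ 0)
    (h0 : (1 + ε)⁻¹ ^ K * ‖(x : X)‖ ≤ ε * ‖((A^[K] x : C) : X)‖)
    (h1 : (1 + ε)⁻¹ ^ K * ‖((A^[2 * K + 1] x : C) : X)‖ ≤ ε * ‖((A^[K] x : C) : X)‖) :
    ∃ z : C, ‖(z : X)‖ = 1 ∧ ‖(A z : X) - z‖ ≤ ε * (3 + L) := by
  have hr : 0 < (1 + ε)⁻¹ := by positivity
  have hr' : (1 + ε) * (1 + ε)⁻¹ = 1 := mul_inv_cancel₀ (by positivity)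
  have hr1 : (1 + ε)⁻¹ ≤ 1 + ε := by
    have : (1 + ε)⁻¹ ≤ 1 := inv_le_one_of_one_le₀ (by linarith)
    linarith
  set r := (1 + ε)⁻¹ with hrdef
  -- With truncated subtraction the exponent is `|m - K|`. Neighbouring weights differ by a factor
  -- of at most `1 + ε`, so applying `A` almost preserves the weighted supremum, apart from the two
  -- end terms.
  let c : ℕ → ℝ := fun m => r ^ ((m - K) + (K - m))
  have hc : ∀ m, 0 ≤ c m := fun m => pow_nonneg hr.le _
  have hcK : c K = 1 := by simp [c]
  have hc0 : c 0 = r ^ K := by simp [c]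
  have hc2 : c (2 * K) = r ^ K := by
    simp only [c]; congr 1; omega
  have hstep : ∀ m, c m ≤ (1 + ε) * c (m + 1) ∧ c (m + 1) ≤ (1 + ε) * c m := by
    intro m
    rcases lt_or_ge m K with h | h
    · have e : (m - K) + (K - m) = ((m + 1 - K) + (K - (m + 1))) + 1 := by omega
      have e' : c m = r * c (m + 1) := by simp only [c]; rw [e, pow_succ']
      have := hc (m + 1)
      constructor
      · rw [e']; exact mul_le_mul_of_nonneg_right hr1 this
      · rw [e', ← mul_assoc, hr', one_mul]
    · have e : (m + 1 - K) + (K - (m + 1)) = ((m - K) + (K - m)) + 1 := by omega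
      have e' : c (m + 1) = r * c m := by simp only [c]; rw [e, pow_succ']
      have := hc m
      constructor
      · rw [e', ← mul_assoc, hr', one_mul]
      · rw [e']; exact mul_le_mul_of_nonneg_right hr1 this
  let y := orbitSup hC c hc (2 * K) A x
  have hAn : ∀ n, (0 : X) ≤ (A^[n] x : C) := fun n => hC.nonneg _ (A^[n] x).2
  have hy0 : (0 : X) ≤ y := hC.nonneg _ y.2
  have hAy0 : (0 : X) ≤ A y := hC.nonneg _ (A y).2
  have hyK : ((A^[K] x : C) : X) ≤ y := by
    simpa [hcK] using smul_iterate_le_orbitSup (hC := hC) c hc (show K ≤ 2 * K by omega) A x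
  have hε1 : 0 ≤ 1 + ε := by positivity
  have hup : (A y : X) ≤ (1 + ε) • (y : X) + r ^ K • ((A^[2 * K + 1] x : C) : X) := by
    rw [hA.map_orbitSup c hc]
    refine Finset.sup'_le _ _ fun j hj => ?_
    rcases (Nat.lt_succ_iff.1 (Finset.mem_range.1 hj)).eq_or_lt with rfl | hj
    · rw [hc2]
      exact le_add_of_nonneg_left (smul_nonneg hε1 hy0)
    · refine le_add_of_le_of_nonneg ?_ (smul_nonneg (pow_nonneg hr.le _) (hAn _))
      refine (smul_le_smul_of_nonneg_right (hstep j).1 (hAn _)).trans ?_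
      rw [mul_smul]
      exact smul_le_smul_of_nonneg_left
        (smul_iterate_le_orbitSup (hC := hC) c hc (by omega) A x) hε1
  have hlow : (y : X) ≤ (1 + ε) • (A y : X) + r ^ K • (x : X) := by
    refine orbitSup_le fun j hj => ?_
    rcases j with _ | j
    · rw [hc0]
      exact le_add_of_nonneg_left (smul_nonneg hε1 hAy0)
    · refine le_add_of_le_of_nonneg ?_ (smul_nonneg (pow_nonneg hr.le _) (hAn 0))
      refine (smul_le_smul_of_nonneg_right (hstep j).2 (hAn _)).trans ?_
      rw [mul_smul, hA.map_orbitSup c hc]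
      exact smul_le_smul_of_nonneg_left
        (Finset.le_sup' (fun j => c j • ((A^[j + 1] x : C) : X))
          (Finset.mem_range.2 (by omega))) hε1
  have hyK' := norm_le_norm_of_nonneg_of_le (hAn K) hyK
  have hypos : 0 < ‖(y : X)‖ := (norm_pos_iff.2 hx).trans_le hyK'
  have habs : |(A y : X) - y| ≤ ε • (y : X) + ε • (A y : X) + r ^ K • (x : X) +
      r ^ K • ((A^[2 * K + 1] x : C) : X) := by
    have p1 : (0 : X) ≤ ε • (y : X) := smul_nonneg hε.le hy0
    have p2 : (0 : X) ≤ ε • (A y : X) := smul_nonneg hε.le hAy0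
    have p3 : (0 : X) ≤ r ^ K • (x : X) := smul_nonneg (pow_nonneg hr.le _) (hAn 0)
    have p4 : (0 : X) ≤ r ^ K • ((A^[2 * K + 1] x : C) : X) :=
      smul_nonneg (pow_nonneg hr.le _) (hAn _)
    rw [add_smul, one_smul] at hup hlow
    refine abs_le'.2 ⟨?_, ?_⟩
    · rw [sub_le_iff_le_add]
      refine hup.trans ?_
      rw [← sub_nonneg]
      convert add_nonneg p2 p3 using 1
      abel
    · rw [neg_sub, sub_le_iff_le_add]
      refine hlow.trans ?_
      rw [← sub_nonneg]
      convert add_nonneg p1 p4 using 1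
      abel
  -- The `3` counts `ε y` and the two end terms, each at most `ε ‖A^K x‖ ≤ ε ‖y‖`; `L` comes from `ε
  -- A y`.
  have hnorm : ‖(A y : X) - y‖ ≤ ε * (3 + L) * ‖(y : X)‖ := by
    refine (norm_le_norm_of_abs_le habs).trans ?_
    refine (norm_add₄_le).trans ?_
    simp only [norm_smul, Real.norm_of_nonneg hε.le, Real.norm_of_nonneg (pow_nonneg hr.le K)]
    have := mul_le_mul_of_nonneg_left (hA.norm_map_le y) hε.le
    have := mul_le_mul_of_nonneg_left hyK' hε.le
    linarith
  have hy : (y : X) ≠ 0 := norm_pos_iff.1 hypos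
  refine ⟨_, exists_norm_eq_one hC y hy, ?_⟩
  rw [hA.map_smul, coe_coneSMul, coe_coneSMul, ← smul_sub, norm_smul, norm_inv, norm_norm,
    inv_mul_eq_div, div_le_iff₀ hypos]
  exact hnorm

theorem one_mem_approxPointSpectrum (hA : IsMaxLinear hC A L)
    (h : ∀ ε > 0, ∃ (K : ℕ) (x : C), ((A^[K] x : C) : X) ≠ 0 ∧
      (1 + ε)⁻¹ ^ K * ‖(x : X)‖ ≤ ε * ‖((A^[K] x : C) : X)‖ ∧
      (1 + ε)⁻¹ ^ K * ‖((A^[2 * K + 1] x : C) : X)‖ ≤ ε * ‖((A^[K] x : C) : X)‖) :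
    1 ∈ approxPointSpectrum A := by
  refine mem_approxPointSpectrum_iff.2 ⟨zero_le_one, fun ε hε => ?_⟩
  have hL : (0 : ℝ) < 3 + L := by positivity
  obtain ⟨K, x, h1, h2, h3⟩ := h (ε / (3 + L)) (by positivity)
  obtain ⟨z, hz, hz'⟩ := hA.exists_norm_map_sub_le (by positivity) h1 h2 h3
  refine ⟨z, hz, ?_⟩
  rwa [one_smul, ← div_mul_cancel₀ ε hL.ne']

/-- After division by `d > 0`, a nearly minimizing unit vector for `A^(2K+1)` has bounded norm at
time `2K+1`, while at time `K` its norm is at least `m(A^K) / d^K`, which decays subexponentially.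
-/
theorem lowerSpectralRadius_mem (hA : IsMaxLinear hC A L) (hC1 : ∃ x : C, ‖(x : X)‖ = 1) :
    lowerSpectralRadius A ∈ approxPointSpectrum A := by
  rcases (hA.lowerSpectralRadius_nonneg hC1).eq_or_lt with h0 | h0
  · rw [← h0]
    refine mem_approxPointSpectrum_iff.2 ⟨le_rfl, fun ε hε => ?_⟩
    have h1 := hA.minModulus_iterate_le hC1 one_ne_zero
    rw [← h0, zero_pow one_ne_zero, Function.iterate_one] at h1
    obtain ⟨x, hx, hx'⟩ := exists_norm_lt_of_minModulus_lt hC1 (h1.trans_lt hε)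
    exact ⟨x, hx, by simpa using hx'.le⟩
  have hlim := hA.tendsto_minModulusRoot hC1
  have hle := fun n (hn : n ≠ 0) => hA.minModulus_iterate_le hC1 hn
  set d := lowerSpectralRadius A
  refine mem_approxPointSpectrum_of_scaleMap (hC := hC) h0
    ((hA.scaleMap _ _).one_mem_approxPointSpectrum fun ε hε => ?_)
  -- `ρ < 1` gives `m(A^K) ≥ (ρ d)^K` for large `K`; `ρ > (1 + ε)⁻¹` leaves room for the factor
  -- `2/ε`.
  obtain ⟨ρ, hρ1, hρ2⟩ := exists_between (inv_lt_one_of_one_lt₀ (by linarith : 1 < 1 + ε))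
  have hr : 0 < (1 + ε)⁻¹ := by positivity
  have hρ : 0 < ρ := hr.trans hρ1
  have hθ : Tendsto (fun K : ℕ => 2 * ((1 + ε)⁻¹ / ρ) ^ K) atTop (𝓝 (2 * 0)) :=
    (tendsto_pow_atTop_nhds_zero_of_lt_one (by positivity)
      ((div_lt_one hρ).2 hρ1)).const_mul 2
  rw [mul_zero] at hθ
  have hev := (hlim.eventually_const_lt (show ρ * d < d by nlinarith)).and
    ((hθ.eventually_lt_const hε).and (eventually_ne_atTop 0))
  obtain ⟨K, hK1, hK2, hK0⟩ := hev.exists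
  have hK3 : (ρ * d) ^ K ≤ minModulus A^[K] := by
    have := pow_le_pow_left₀ (by positivity) hK1.le K
    rwa [minModulusRoot, one_div, Real.rpow_inv_natCast_pow (minModulus_nonneg _) hK0] at this
  have hK4 : 2 * (1 + ε)⁻¹ ^ K ≤ ε * ρ ^ K := by
    rw [div_pow, ← mul_div_assoc, div_lt_iff₀ (by positivity)] at hK2
    exact hK2.le
  obtain ⟨x, hx, hx'⟩ := exists_norm_lt_of_minModulus_lt (r := 2 * d ^ (2 * K + 1)) hC1
    ((hle (2 * K + 1) (by omega)).trans_lt (by linarith [pow_pos h0 (2 * K + 1)]))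
  have hnorm : ∀ n, ‖(((scaleMap hC d⁻¹ (inv_nonneg.2 h0.le) A)^[n] x : C) : X)‖ =
      (d ^ n)⁻¹ * ‖((A^[n] x : C) : X)‖ := fun n => by
    rw [hA.iterate_scaleMap, coe_coneSMul, norm_smul, norm_pow, norm_inv, inv_pow,
      Real.norm_of_nonneg h0.le]
  have hlow : ρ ^ K ≤ (d ^ K)⁻¹ * ‖((A^[K] x : C) : X)‖ := by
    rw [inv_mul_eq_div, le_div_iff₀ (by positivity), ← mul_pow]
    exact hK3.trans (minModulus_le hx)
  have hup : (d ^ (2 * K + 1))⁻¹ * ‖((A^[2 * K + 1] x : C) : X)‖ ≤ 2 := by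
    rw [inv_mul_eq_div, div_le_iff₀ (by positivity)]
    exact hx'.le
  have hεlow := mul_le_mul_of_nonneg_left hlow hε.le
  have hrK : 0 < (1 + ε)⁻¹ ^ K := by positivity
  refine ⟨K, x, norm_pos_iff.1 ?_, ?_, ?_⟩
  · rw [hnorm]
    exact (pow_pos hρ K).trans_le hlow
  · rw [hnorm, hx]
    linarith
  · rw [hnorm, hnorm]
    nlinarith [mul_le_mul_of_nonneg_left hup hrK.le]

end IsMaxLinear

end MaxLinear

/-! ### The scalar function `q_∨`. -/

section MaxPolyFun

variable {q : Polynomial ℝ}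

theorem coeff_mul_pow_le_maxPolyFun (q : Polynomial ℝ) (t : ℝ) {j : ℕ} (hj : j ≤ q.natDegree) :
    q.coeff j * t ^ j ≤ maxPolyFun q t :=
  Finset.le_sup' (fun j => q.coeff j * t ^ j) (Finset.mem_range.2 (Nat.lt_succ_of_le hj))

theorem maxPolyFun_le {t b : ℝ} (h : ∀ j ≤ q.natDegree, q.coeff j * t ^ j ≤ b) :
    maxPolyFun q t ≤ b :=
  Finset.sup'_le Finset.nonempty_range_add_one _ fun j hj =>
    h j (Nat.lt_succ_iff.1 (Finset.mem_range.1 hj))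

theorem exists_maxPolyFun_eq (q : Polynomial ℝ) (t : ℝ) :
    ∃ j ≤ q.natDegree, maxPolyFun q t = q.coeff j * t ^ j := by
  obtain ⟨j, hj, h⟩ := Finset.exists_mem_eq_sup'
    (Finset.nonempty_range_add_one (n := q.natDegree)) fun j => q.coeff j * t ^ j
  exact ⟨j, Nat.lt_succ_iff.1 (Finset.mem_range.1 hj), h⟩

theorem coeff_zero_le_maxPolyFun (q : Polynomial ℝ) (t : ℝ) : q.coeff 0 ≤ maxPolyFun q t := by
  simpa using coeff_mul_pow_le_maxPolyFun q t (Nat.zero_le _)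

theorem maxPolyFun_zero_le (hq : ∀ j, 0 ≤ q.coeff j) : maxPolyFun q 0 ≤ q.coeff 0 := by
  refine maxPolyFun_le fun j _ => ?_
  rcases eq_or_ne j 0 with rfl | hj
  · simp
  · simpa [hj] using hq 0

theorem maxPolyFun_nonneg (hq : ∀ j, 0 ≤ q.coeff j) (t : ℝ) : 0 ≤ maxPolyFun q t :=
  (hq 0).trans (coeff_zero_le_maxPolyFun q t)

theorem continuous_maxPolyFun (q : Polynomial ℝ) : Continuous (maxPolyFun q) :=
  Continuous.finset_sup'_apply _ fun _ _ => by fun_prop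

/-- Intermediate value theorem between `0`, where `q_∨` is `α_0`, and a point where the leading
monomial reaches `s`. -/
theorem exists_maxPolyFun_eq_of_coeff_zero_lt (hq : ∀ j, 0 ≤ q.coeff j) (hdeg : q.natDegree ≠ 0)
    {s : ℝ} (hs : q.coeff 0 < s) : ∃ t > 0, maxPolyFun q t = s := by
  have hlead : 0 < q.coeff q.natDegree :=
    (hq _).lt_of_ne' (Polynomial.leadingCoeff_ne_zero.2 (by rintro rfl; simp at hdeg))
  have hlim : Tendsto (fun t : ℝ => q.coeff q.natDegree * t ^ q.natDegree) atTop atTop :=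
    (tendsto_pow_atTop hdeg).const_mul_atTop hlead
  obtain ⟨T, hT, hT0⟩ := ((hlim.eventually_ge_atTop s).and (eventually_ge_atTop 0)).exists
  obtain ⟨t, ⟨ht0, -⟩, ht⟩ := intermediate_value_Icc hT0 (continuous_maxPolyFun q).continuousOn
    ⟨(maxPolyFun_zero_le hq).trans hs.le, hT.trans (coeff_mul_pow_le_maxPolyFun q T le_rfl)⟩
  refine ⟨t, ht0.lt_of_ne ?_, ht⟩
  rintro rfl
  exact (ht.symm.le.trans (maxPolyFun_zero_le hq)).not_gt hs

end MaxPolyFun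

/-! ### Inequalities up to an error vanishing in norm. -/

section AsympLE

variable {X : Type*} [NormedAddCommGroup X] [Lattice X]

/-- The sequence `u` is at most `v` up to an error which tends to zero in norm. -/
def AsympLE (u v : ℕ → X) : Prop :=
  Tendsto (fun n => ‖(u n - v n)⁺‖) atTop (𝓝 0)

namespace AsympLE

variable {u v w : ℕ → X}

theorem const_smul [NormedSpace ℝ X] [IsOrderedModule ℝ X] (h : AsympLE u v) {c : ℝ}
    (hc : 0 ≤ c) :
    AsympLE (fun n => c • u n) fun n => c • v n := by
  have := h.const_mul c
  rw [mul_zero] at this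
  refine this.congr fun n => ?_
  rw [← smul_sub, posPart_smul_of_nonneg hc, norm_smul, Real.norm_of_nonneg hc]

variable [IsOrderedAddMonoid X]

theorem of_le (h : ∀ n, u n ≤ v n) : AsympLE u v :=
  tendsto_const_nhds.congr fun n => by rw [posPart_eq_zero.2 (sub_nonpos.2 (h n)), norm_zero]

variable [HasSolidNorm X]

theorem of_tendsto_norm_sub (h : Tendsto (fun n => ‖u n - v n‖) atTop (𝓝 0)) : AsympLE u v :=
  squeeze_zero (fun _ => norm_nonneg _) (fun _ => norm_posPart_le _) h

theorem trans (h : AsympLE u v) (h' : AsympLE v w) : AsympLE u w := by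
  refine squeeze_zero (fun _ => norm_nonneg _) (fun n => ?_) (by simpa using h.add h')
  exact (norm_le_norm_of_nonneg_of_le (posPart_nonneg _) (posPart_sub_le_add _ _ _)).trans
    (norm_add_le _ _)

theorem finset_sup'_le {ι : Type*} {s : Finset ι} (hs : s.Nonempty) {f : ι → ℕ → X}
    (h : ∀ i ∈ s, AsympLE (f i) v) : AsympLE (fun n => s.sup' hs fun i => f i n) v := by
  refine squeeze_zero (fun _ => norm_nonneg _) (fun n => ?_)
    (by simpa using tendsto_finsetSum s h)
  exact (norm_le_norm_of_nonneg_of_le (posPart_nonneg _) (posPart_sup'_sub_le _ _ _)).trans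
    (norm_sum_le _ _)

/-- Used to discard the constant term of the max-polynomial, whose relative weight `α_0/s` is below
one. -/
theorem of_smul_sup [NormedSpace ℝ X] [IsOrderedModule ℝ X] (hu : ∀ n, 0 ≤ u n)
    (hv : ∀ n, 0 ≤ v n) {a : ℝ} (ha0 : 0 ≤ a) (ha1 : a < 1)
    (h : AsympLE u fun n => a • u n ⊔ v n) : AsympLE u v := by
  have ha : 0 < 1 - a := sub_pos.2 ha1
  refine squeeze_zero (fun _ => norm_nonneg _) (fun n => ?_)
    (by simpa using Tendsto.const_mul (1 - a)⁻¹ h)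
  have := norm_le_norm_of_nonneg_of_le (smul_nonneg ha.le (posPart_nonneg _))
    (smul_posPart_sub_le (hu n) (hv n) ha0 ha1)
  rwa [norm_smul, Real.norm_of_nonneg ha.le, ← le_inv_mul_iff₀ ha] at this

end AsympLE

end AsympLE

/-! ### Spectral mapping for max-polynomials. -/

section MaxLinear

variable {X : Type*} [NormedAddCommGroup X] [NormedSpace ℝ X] [Lattice X]
  {C : Set X} {hC : IsMaxCone C} {A B : C → C} {L M : NNReal}

namespace IsMaxLinear

/-- Induction: compare `A (A^n x)` with `A (s^n x)` by the Lipschitz bound, then `s^n A x` with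
`s^(n+1) x`. -/
theorem exists_norm_iterate_sub_le (hA : IsMaxLinear hC A L) {s : ℝ} (hs : 0 ≤ s) (n : ℕ) :
    ∃ R, 0 ≤ R ∧ ∀ x : C, ‖((A^[n] x : C) : X) - s ^ n • (x : X)‖ ≤
      R * ‖(A x : X) - s • (x : X)‖ := by
  induction n with
  | zero => exact ⟨0, le_rfl, fun x => by simp⟩
  | succ n ih =>
    obtain ⟨R, hR, h⟩ := ih
    refine ⟨L * R + s ^ n, by positivity, fun x => ?_⟩
    have hsn : 0 ≤ s ^ n := pow_nonneg hs n
    have h1 := hA.norm_map_sub_le (A^[n] x) (coneSMul hC (s ^ n) hsn x)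
    rw [hA.map_smul, coe_coneSMul, coe_coneSMul] at h1
    have h2 : ((A^[n + 1] x : C) : X) - s ^ (n + 1) • (x : X) =
        ((A (A^[n] x) : C) - s ^ n • (A x : X)) + s ^ n • ((A x : X) - s • (x : X)) := by
      rw [Function.iterate_succ_apply', smul_sub, smul_smul, pow_succ]
      abel
    rw [h2]
    refine (norm_add_le _ _).trans ?_
    rw [norm_smul, Real.norm_of_nonneg hsn, add_mul, mul_assoc]
    gcongr
    exact h1.trans (mul_le_mul_of_nonneg_left (h x) L.2)

theorem lowerSpectralRadius_le (hA : IsMaxLinear hC A L) {s : ℝ}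
    (hs : s ∈ approxPointSpectrum A) : lowerSpectralRadius A ≤ s := by
  have hC1 := exists_norm_eq_one_of_mem_approxPointSpectrum hs
  rw [mem_approxPointSpectrum_iff] at hs
  refine le_of_tendsto (hA.tendsto_minModulusRoot hC1) ?_
  filter_upwards [eventually_ne_atTop 0] with n hn
  obtain ⟨R, hR, h⟩ := hA.exists_norm_iterate_sub_le hs.1 n
  have hm : minModulus A^[n] ≤ s ^ n := by
    refine le_of_forall_pos_le_add fun ε hε => ?_
    obtain ⟨x, hx, hx'⟩ := hs.2 (ε / (R + 1)) (by positivity)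
    refine (minModulus_le hx).trans ?_
    have h1 := norm_le_norm_add_norm_sub' ((A^[n] x : C) : X) (s ^ n • (x : X))
    rw [norm_smul, hx, mul_one, Real.norm_of_nonneg (pow_nonneg hs.1 n)] at h1
    have h2 := h x
    rw [le_div_iff₀ (by positivity)] at hx'
    nlinarith [norm_nonneg ((A x : X) - s • (x : X))]
  rw [minModulusRoot, one_div]
  calc _ ≤ (s ^ n) ^ ((n : ℝ)⁻¹) :=
        Real.rpow_le_rpow (minModulus_nonneg _) hm (by positivity)
    _ = s := Real.pow_rpow_inv_natCast hs.1 hn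

theorem minModulus_iterate_scaleMap (hA : IsMaxLinear hC A L) (hC1 : ∃ x : C, ‖(x : X)‖ = 1)
    {t : ℝ} (ht : 0 ≤ t) (n : ℕ) :
    t ^ n * minModulus A^[n] ≤ minModulus (scaleMap hC t ht A)^[n] := by
  refine le_minModulus hC1 fun x hx => ?_
  rw [hA.iterate_scaleMap, coe_coneSMul, norm_smul, norm_pow, Real.norm_of_nonneg ht]
  exact mul_le_mul_of_nonneg_left (minModulus_le hx) (pow_nonneg ht n)

variable [IsOrderedAddMonoid X] [HasSolidNorm X]

theorem asympLE_map (hA : IsMaxLinear hC A L) {u v : ℕ → C}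
    (h : AsympLE (fun n => (u n : X)) fun n => (v n : X)) :
    AsympLE (fun n => (A (u n) : X)) fun n => (A (v n) : X) :=
  squeeze_zero (fun _ => norm_nonneg _) (fun n => hA.norm_posPart_map_sub_le (u n) (v n))
    (by simpa using Tendsto.const_mul (L : ℝ) h)

theorem minModulus_iterate_mono (hB : IsMaxLinear hC B M) (hC1 : ∃ x : C, ‖(x : X)‖ = 1)
    (h : ∀ x, (A x : X) ≤ B x) (n : ℕ) :
    minModulus A^[n] ≤ minModulus B^[n] := by
  have hle : ∀ (n : ℕ) (x : C), ((A^[n] x : C) : X) ≤ (B^[n] x : C) := by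
    intro n x
    induction n with
    | zero => rfl
    | succ n ih =>
      rw [Function.iterate_succ_apply', Function.iterate_succ_apply']
      exact (h _).trans (hB.mono ih)
  exact le_minModulus hC1 fun x hx => (minModulus_le hx).trans
    (norm_le_norm_of_nonneg_of_le (hC.nonneg _ (A^[n] x).2) (hle n x))

/-- If `t A^j ≤ B`, then `t d(A)^j ≤ d(B)`. -/
theorem mul_lowerSpectralRadius_pow_le (hA : IsMaxLinear hC A L) (hB : IsMaxLinear hC B M)
    (hC1 : ∃ x : C, ‖(x : X)‖ = 1) {t : ℝ} (ht : 0 ≤ t) (j : ℕ)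
    (h : ∀ x, t • ((A^[j] x : C) : X) ≤ B x) :
    t * lowerSpectralRadius A ^ j ≤ lowerSpectralRadius B := by
  have hm : ∀ N, t ^ N * minModulus A^[j * N] ≤ minModulus B^[N] := fun N => by
    rw [Function.iterate_mul]
    exact ((hA.iterate j).minModulus_iterate_scaleMap hC1 ht N).trans
      (hB.minModulus_iterate_mono hC1 h N)
  -- For `j = 0` the indices `j * N` do not tend to infinity, so `N = 1` is used instead of a limit.
  rcases eq_or_ne j 0 with rfl | hj
  · have h1 := (hm 1).trans (hB.minModulus_iterate_le hC1 one_ne_zero)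
    have h2 : 1 ≤ minModulus (A^[0 * 1]) := le_minModulus hC1 fun x hx => by simp [hx]
    rw [pow_one, pow_one] at h1
    rw [pow_zero]
    exact (mul_le_mul_of_nonneg_left h2 ht).trans h1
  · have hlim : Tendsto (fun N : ℕ => t * minModulusRoot A (j * N) ^ j) atTop
        (𝓝 (t * lowerSpectralRadius A ^ j)) :=
      (((hA.tendsto_minModulusRoot hC1).comp
        (tendsto_id.const_mul_atTop' (Nat.pos_of_ne_zero hj))).pow j).const_mul t
    refine le_of_tendsto hlim ?_
    filter_upwards [eventually_ne_atTop 0] with N hN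
    have h1 := (hm N).trans (hB.minModulus_iterate_le hC1 hN)
    have hroot : minModulusRoot A (j * N) ^ (j * N) = minModulus A^[j * N] := by
      rw [minModulusRoot, one_div,
        Real.rpow_inv_natCast_pow (minModulus_nonneg _) (mul_ne_zero hj hN)]
    have hroot0 : 0 ≤ minModulusRoot A (j * N) := Real.rpow_nonneg (minModulus_nonneg _) _
    refine (pow_le_pow_iff_left₀ (mul_nonneg ht (pow_nonneg hroot0 j))
      (hB.lowerSpectralRadius_nonneg hC1) hN).1 ?_
    rwa [mul_pow, ← pow_mul, hroot]

variable [IsOrderedModule ℝ X]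

/-- Let `u` be a sequence of unit vectors with `A^k u ≤ u` asymptotically for some `k ≥ 1`. If `u`
is asymptotically at most `a u ∨ A u ∨ ⋯ ∨ A^n u` for some `a < 1`, then `1` is an approximate
eigenvalue of `A`. -/
theorem one_mem_approxPointSpectrum_of_asympLE (hA : IsMaxLinear hC A L) {u : ℕ → C}
    (hu : ∀ i, ‖(u i : X)‖ = 1) {k : ℕ} (hk : k ≠ 0)
    (hAk : AsympLE (fun i => ((A^[k] (u i) : C) : X)) fun i => (u i : X))
    {a : ℝ} (ha0 : 0 ≤ a) (ha1 : a < 1) {n : ℕ}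
    (h : ∀ v : ℕ → C,
      (∀ j ≠ 0, j ≤ n → AsympLE (fun i => ((A^[j] (u i) : C) : X)) fun i => (v i : X)) →
      AsympLE (fun i => (u i : X)) fun i => a • (u i : X) ⊔ (v i : X)) :
    1 ∈ approxPointSpectrum A := by
  let c : ℕ → ℝ := fun _ => 1
  have hc : ∀ j, 0 ≤ c j := fun _ => zero_le_one
  -- For `y = u ∨ A u ∨ ⋯ ∨ A^(k-1) u` the hypothesis on `A^k` gives `A y ≤ y` asymptotically.
  let y : ℕ → C := fun i => orbitSup hC c hc (k - 1) A (u i)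
  have hle : ∀ i, ∀ j ≤ k - 1, ((A^[j] (u i) : C) : X) ≤ y i := fun i j hj => by
    simpa [c] using smul_iterate_le_orbitSup (hC := hC) c hc hj A (u i)
  have hAy : AsympLE (fun i => (A (y i) : X)) fun i => (y i : X) := by
    simp only [y, hA.map_orbitSup c hc]
    refine AsympLE.finset_sup'_le _ fun j hj => ?_
    simp only [c, one_smul]
    rcases (Nat.lt_succ_iff.1 (Finset.mem_range.1 hj)).eq_or_lt with rfl | hj
    · rw [Nat.sub_add_cancel (Nat.pos_of_ne_zero hk)]
      exact hAk.trans (AsympLE.of_le fun i => hle i 0 (Nat.zero_le _))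
    · exact AsympLE.of_le fun i => hle i (j + 1) hj
  have hdesc : ∀ m N, AsympLE (fun i => ((A^[m + N] (y i) : C) : X))
      fun i => ((A^[N] (y i) : C) : X) := by
    intro m N
    induction m with
    | zero => rw [zero_add]; exact AsympLE.of_le fun _ => le_rfl
    | succ m ih =>
      refine AsympLE.trans ?_ ih
      have : m + 1 + N = (m + N) + 1 := by ring
      simp only [this, Function.iterate_succ_apply]
      exact (hA.iterate (m + N)).asympLE_map hAy
  have hu0 : ∀ i, (0 : X) ≤ u i := fun i => hC.nonneg _ (u i).2
  -- If `u ≤ A^N y`, then `A^j u ≤ A^(N+j) y ≤ A^(N+1) y` for `j ≥ 1`, so `v = A^(N+1) y` is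
  -- admissible in `h` and `a < 1` yields `u ≤ A^(N+1) y`.
  have huy : ∀ N, AsympLE (fun i => (u i : X)) fun i => ((A^[N] (y i) : C) : X) := by
    intro N
    induction N with
    | zero => exact AsympLE.of_le fun i => hle i 0 (Nat.zero_le _)
    | succ N ih =>
      refine AsympLE.of_smul_sup hu0 (fun i => hC.nonneg _ (A^[N + 1] (y i)).2) ha0 ha1
        (h _ fun j hj _ => ?_)
      refine ((hA.iterate j).asympLE_map ih).trans ?_
      obtain ⟨m, rfl⟩ := Nat.exists_eq_succ_of_ne_zero hj
      have := hdesc m (N + 1)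
      have e : m + (N + 1) = m.succ + N := by omega
      simpa only [e, Function.iterate_add_apply A m.succ N] using this
  refine hA.one_mem_approxPointSpectrum fun ε hε => ?_
  obtain ⟨R, hR⟩ : ∃ R : ℝ, ∀ i, ‖(y i : X)‖ ≤ R :=
    ⟨_, fun i => (hA.norm_orbitSup_le c hc (k - 1) (u i)).trans_eq (by rw [hu i, mul_one])⟩
  have hθ : Tendsto (fun K : ℕ => (R + 1) * ((1 + ε)⁻¹) ^ K) atTop (𝓝 ((R + 1) * 0)) :=
    (tendsto_pow_atTop_nhds_zero_of_lt_one (by positivity)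
      (inv_lt_one_of_one_lt₀ (by linarith))).const_mul (R + 1)
  rw [mul_zero] at hθ
  -- `K` is fixed before `i`, since the errors vanish only for each fixed number of iterations. The
  -- bound `R` does not depend on `i`.
  obtain ⟨K, hK⟩ := (hθ.eventually_lt_const (half_pos hε)).exists
  obtain ⟨i, hi1, hi2⟩ := (((huy K).eventually_lt_const (half_pos one_pos)).and
    ((hdesc (2 * K + 1) 0).eventually_lt_const one_pos)).exists
  have hlow : 1 / 2 ≤ ‖((A^[K] (y i) : C) : X)‖ := by
    have := norm_le_add_norm_posPart_sub (hu0 i) ((A^[K] (y i) : C) : X)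
    rw [hu i] at this
    linarith
  have hup : ‖((A^[2 * K + 1] (y i) : C) : X)‖ ≤ R + 1 := by
    have := norm_le_add_norm_posPart_sub (hC.nonneg _ (A^[2 * K + 1] (y i)).2) (y i : X)
    simp only [add_zero, Function.iterate_zero_apply] at hi2
    linarith [hR i]
  have hr : 0 < (1 + ε)⁻¹ ^ K := by positivity
  have hεlow := mul_le_mul_of_nonneg_left hlow hε.le
  refine ⟨K, y i, norm_pos_iff.1 (by linarith), ?_, ?_⟩
  · linarith [mul_le_mul_of_nonneg_left (hR i) hr.le]
  · linarith [mul_le_mul_of_nonneg_left hup hr.le]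

variable {q : Polynomial ℝ} (hq : ∀ j, 0 ≤ q.coeff j)

theorem maxPolyMap (hA : IsMaxLinear hC A L) : ∃ M, IsMaxLinear hC (maxPolyMap hC q hq A) M :=
  ⟨_, hA.orbitSup q.coeff hq q.natDegree⟩

theorem maxPolyFun_lowerSpectralRadius_le (hA : IsMaxLinear hC A L)
    (hC1 : ∃ x : C, ‖(x : X)‖ = 1) :
    maxPolyFun q (lowerSpectralRadius A) ≤
      lowerSpectralRadius (MaxSpectral.maxPolyMap hC q hq A) := by
  obtain ⟨M, hB⟩ := hA.maxPolyMap hq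
  exact maxPolyFun_le fun j hj => hA.mul_lowerSpectralRadius_pow_le hB hC1 (hq j) j fun x =>
    smul_iterate_le_orbitSup (hC := hC) q.coeff hq hj A x

theorem maxPolyFun_mem_approxPointSpectrum (hA : IsMaxLinear hC A L) {s : ℝ}
    (hs : s ∈ approxPointSpectrum A) :
    maxPolyFun q s ∈ approxPointSpectrum (MaxSpectral.maxPolyMap hC q hq A) := by
  rw [mem_approxPointSpectrum_iff] at hs ⊢
  refine ⟨maxPolyFun_nonneg hq s, fun ε hε => ?_⟩
  choose R hR0 hR using hA.exists_norm_iterate_sub_le hs.1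
  let S := ∑ j ∈ Finset.range (q.natDegree + 1), q.coeff j * R j
  have hS : 0 ≤ S := Finset.sum_nonneg fun j _ => mul_nonneg (hq j) (hR0 j)
  obtain ⟨x, hx, hx'⟩ := hs.2 (ε / (S + 1)) (by positivity)
  refine ⟨x, hx, ?_⟩
  have hx0 : (0 : X) ≤ x := hC.nonneg _ x.2
  have hfun : maxPolyFun q s • (x : X) = (Finset.range (q.natDegree + 1)).sup'
      Finset.nonempty_range_add_one fun j => q.coeff j • s ^ j • (x : X) := by
    simp only [smul_smul]
    -- A monotone map on a linear order preserves joins.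
    have hmono : Monotone fun r : ℝ => r • (x : X) := fun _ _ h =>
      smul_le_smul_of_nonneg_right h hx0
    exact Finset.apply_sup'_eq_sup'_comp _ (fun r : ℝ => r • (x : X)) fun r r' => hmono.map_sup r r'
  rw [hfun, maxPolyMap_eq_orbitSup]
  refine (norm_orbitSup_sub_le (hC := hC) q.coeff hq q.natDegree A x fun j => s ^ j • (x : X)).trans
    ?_
  have h1 : ∑ j ∈ Finset.range (q.natDegree + 1),
      q.coeff j * ‖((A^[j] x : C) : X) - s ^ j • (x : X)‖ ≤ S * ‖(A x : X) - s • (x : X)‖ := by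
    rw [Finset.sum_mul]
    refine Finset.sum_le_sum fun j _ => ?_
    rw [mul_assoc]
    exact mul_le_mul_of_nonneg_left (hR j x) (hq j)
  rw [le_div_iff₀ (by positivity)] at hx'
  linarith [norm_nonneg ((A x : X) - s • (x : X))]

theorem exists_maxPolyFun_eq_of_mem (hA : IsMaxLinear hC A L) {s : ℝ}
    (hs : s ∈ approxPointSpectrum (MaxSpectral.maxPolyMap hC q hq A)) :
    ∃ t ∈ approxPointSpectrum A, maxPolyFun q t = s := by
  have hC1 := exists_norm_eq_one_of_mem_approxPointSpectrum hs
  obtain ⟨M, hB⟩ := hA.maxPolyMap hq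
  have hds := (hA.maxPolyFun_lowerSpectralRadius_le hq hC1).trans (hB.lowerSpectralRadius_le hs)
  have h0d := coeff_zero_le_maxPolyFun q (lowerSpectralRadius A)
  rcases (h0d.trans hds).eq_or_lt with h0s | h0s
  · exact ⟨_, hA.lowerSpectralRadius_mem hC1, le_antisymm hds (h0s ▸ h0d)⟩
  have hs0 : 0 < s := (hq 0).trans_lt h0s
  rw [mem_approxPointSpectrum_iff] at hs
  -- For a constant `q`, `B` is multiplication by `α_0`, which would force `s ≤ α_0`.
  have hdeg : q.natDegree ≠ 0 := fun hdeg => by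
    refine h0s.not_ge (le_of_forall_pos_le_add fun ε hε => ?_)
    obtain ⟨x, hx, hx'⟩ := hs.2 ε hε
    have h1 : ((MaxSpectral.maxPolyMap hC q hq A x : C) : X) = q.coeff 0 • (x : X) := by
      change maxPolyVec q A x = _
      simp [maxPolyVec, hdeg]
    rw [h1, ← sub_smul, norm_smul, hx, mul_one, Real.norm_eq_abs] at hx'
    linarith [neg_le_abs (q.coeff 0 - s)]
  obtain ⟨t, ht, hts⟩ := exists_maxPolyFun_eq_of_coeff_zero_lt hq hdeg h0s
  refine ⟨t, ?_, hts⟩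
  choose u hu hu' using fun i : ℕ => hs.2 (1 / ((i : ℝ) + 1)) (by positivity)
  have hlim : Tendsto (fun i => ‖((MaxSpectral.maxPolyMap hC q hq A (u i) : C) : X) -
      s • (u i : X)‖) atTop (𝓝 0) :=
    squeeze_zero (fun _ => norm_nonneg _) hu' tendsto_one_div_add_atTop_nhds_zero_nat
  have hle := AsympLE.of_tendsto_norm_sub hlim
  have hge : AsympLE _ _ := AsympLE.of_tendsto_norm_sub (by simpa only [norm_sub_rev] using hlim)
  have hu0 : ∀ i, (0 : X) ≤ u i := fun i => hC.nonneg _ (u i).2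
  have hcoeff : ∀ j ≤ q.natDegree, AsympLE (fun i => q.coeff j • ((A^[j] (u i) : C) : X))
      fun i => s • (u i : X) := fun j hj =>
    (AsympLE.of_le fun i =>
      smul_iterate_le_orbitSup (hC := hC) q.coeff hq hj A (u i)).trans hle
  obtain ⟨k, hk, hks⟩ := exists_maxPolyFun_eq q t
  rw [hts] at hks
  have hk0 : k ≠ 0 := by
    rintro rfl
    rw [pow_zero, mul_one] at hks
    exact h0s.ne' hks
  have htj : ∀ j, 0 < t ^ j := fun j => pow_pos ht j
  set A' := scaleMap hC t⁻¹ (inv_nonneg.2 ht.le) A with hA'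
  have hA'j : ∀ j x, ((A'^[j] x : C) : X) = (t ^ j)⁻¹ • ((A^[j] x : C) : X) := fun j x => by
    rw [hA', hA.iterate_scaleMap, coe_coneSMul, inv_pow]
  refine mem_approxPointSpectrum_of_scaleMap (hC := hC) ht
    ((hA.scaleMap _ _).one_mem_approxPointSpectrum_of_asympLE hu hk0 ?_
      (a := s⁻¹ * q.coeff 0) (n := q.natDegree) (mul_nonneg (inv_nonneg.2 hs0.le) (hq 0)) ?_
      fun v hv => ?_)
  · have := (hcoeff k hk).const_smul (inv_nonneg.2 hs0.le)
    simp only [smul_smul, inv_mul_cancel₀ hs0.ne', one_smul] at this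
    simp only [← hA', hA'j]
    -- The index `k` attains the maximum: `α_k t^k = s`.
    have e : s⁻¹ * q.coeff k = (t ^ k)⁻¹ := by
      have := htj k
      have hc : q.coeff k ≠ 0 := by
        intro hc
        rw [hc, zero_mul] at hks
        exact hs0.ne' hks
      rw [hks]
      field_simp
    rwa [e] at this
  · rw [inv_mul_lt_iff₀ hs0, mul_one]
    exact h0s
  · have h1 := hge.const_smul (inv_nonneg.2 hs0.le)
    simp only [smul_smul, inv_mul_cancel₀ hs0.ne', one_smul] at h1
    refine h1.trans ?_
    simp only [maxPolyMap_eq_orbitSup, coe_orbitSup, smul_sup'_of_nonneg _ (inv_nonneg.2 hs0.le),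
      smul_smul]
    refine AsympLE.finset_sup'_le _ fun j hj => ?_
    rcases eq_or_ne j 0 with rfl | hj0
    · exact AsympLE.of_le fun i => le_sup_left
    · have hj' := Nat.lt_succ_iff.1 (Finset.mem_range.1 hj)
      refine AsympLE.trans (AsympLE.of_le fun i => ?_)
        ((hv j hj0 hj').trans (AsympLE.of_le fun i => le_sup_right))
      rw [← hA', hA'j]
      refine smul_le_smul_of_nonneg_right ?_ (hC.nonneg _ (A^[j] (u i)).2)
      rw [inv_mul_le_iff₀ hs0, ← div_eq_mul_inv, le_div_iff₀ (htj j), ← hts]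
      exact coeff_mul_pow_le_maxPolyFun q t hj'

theorem approxPointSpectrum_maxPolyMap (hA : IsMaxLinear hC A L) :
    approxPointSpectrum (MaxSpectral.maxPolyMap hC q hq A) =
      maxPolyFun q '' approxPointSpectrum A := by
  refine Set.Subset.antisymm (fun s hs => hA.exists_maxPolyFun_eq_of_mem hq hs) ?_
  rintro _ ⟨s, hs, rfl⟩
  exact hA.maxPolyFun_mem_approxPointSpectrum hq hs

theorem lowerSpectralRadius_maxPolyMap (hA : IsMaxLinear hC A L)
    (hC1 : ∃ x : C, ‖(x : X)‖ = 1) :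
    lowerSpectralRadius (MaxSpectral.maxPolyMap hC q hq A) =
      maxPolyFun q (lowerSpectralRadius A) := by
  obtain ⟨M, hB⟩ := hA.maxPolyMap hq
  exact le_antisymm
    (hB.lowerSpectralRadius_le
      (hA.maxPolyFun_mem_approxPointSpectrum hq (hA.lowerSpectralRadius_mem hC1)))
    (hA.maxPolyFun_lowerSpectralRadius_le hq hC1)

end IsMaxLinear

end MaxLinear

end MaxSpectral

/-- The convergence conjuncts say that both lower spectral radii are genuine limits. -/
theorem theorem4p10 {X : Type*} [NormedAddCommGroup X] [NormedSpace ℝ X] [Lattice X]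
    [IsOrderedAddMonoid X] [IsOrderedModule ℝ X] [HasSolidNorm X]
    (C : Set X) (hC : MaxSpectral.IsMaxCone C) (hC0 : ∃ x ∈ C, x ≠ 0)
    (A : C → C) (hLip : ∃ L : NNReal, LipschitzWith L A)
    (hhom : MaxSpectral.IsPosHomogeneous hC A) (hsup : MaxSpectral.PreservesSup hC A)
    (q : Polynomial ℝ) (hq : ∀ j, 0 ≤ q.coeff j) :
    MaxSpectral.approxPointSpectrum (MaxSpectral.maxPolyMap hC q hq A) =
        MaxSpectral.maxPolyFun q '' MaxSpectral.approxPointSpectrum A ∧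
      Tendsto (MaxSpectral.minModulusRoot A) atTop (𝓝 (MaxSpectral.lowerSpectralRadius A)) ∧
      Tendsto (MaxSpectral.minModulusRoot (MaxSpectral.maxPolyMap hC q hq A)) atTop
        (𝓝 (MaxSpectral.lowerSpectralRadius (MaxSpectral.maxPolyMap hC q hq A))) ∧
      MaxSpectral.lowerSpectralRadius (MaxSpectral.maxPolyMap hC q hq A) =
        MaxSpectral.maxPolyFun q (MaxSpectral.lowerSpectralRadius A) := by
  obtain ⟨L, hL⟩ := hLip
  have hA : MaxSpectral.IsMaxLinear hC A L := ⟨hhom, hsup, hL⟩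
  obtain ⟨x, hx, hx0⟩ := hC0
  have hC1 : ∃ x : C, ‖(x : X)‖ = 1 := ⟨_, MaxSpectral.exists_norm_eq_one hC ⟨x, hx⟩ hx0⟩
  obtain ⟨M, hB⟩ := hA.maxPolyMap hq
  exact ⟨hA.approxPointSpectrum_maxPolyMap hq, hA.tendsto_minModulusRoot hC1,
    hB.tendsto_minModulusRoot hC1, hA.lowerSpectralRadius_maxPolyMap hq hC1⟩
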